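/- **Theorem 1 (Multiple Sphere Lower Bound).** Let $N\ge 1$, $K\ge 1$, $L\ge 0$ be integers, $\rho>0$ and $m\ge \tfrac12$. Let $M=[v_1\,\cdots\,v_N]\in\mathbb{R}^{N\times N}$ with $|\det M|=1$, and consider the $K$-PAM lattice constellation $\{Mu : u\in\{0,\dots,K-1\}^N\}$. Let $h_1,\dots,h_N$ be real random variables on a probability space, each with the Nakagami-$m$ density $\frac{2m^m x^{2m-1}}{\Gamma(m)}e^{-mx^2}$ on $x>0$ (in particular, they may be independent), and put $H=\operatorname{diag}(h_1,\dots,h_N)$, $\gamma_i=h_i^2$, $\sigma^2=1/\rho$. For $S\subseteq\{1,\dots,N\}$ with $|S|=k\ge1$ let $\mathcal V_S(H)$ be the Voronoi cell around the origin of the faded sublattice $\bigoplus_{i\in S}\mathbb{Z}\,Hv_i$, taken inside the real span of the vectors $Hv_i$, $i\in S$, and let $$J_S(H)=\int_{\mathcal V_S(H)}(2\pi\sigma^2)^{-k/2}e^{-\|z\|^2/(2\sigma^2)}\,dz ,\qquad J_\emptyset(H)=1,$$ where $dz$ is Lebesgue measure on that span. The frame error probability of the constellation, for frames of $L$ symbols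 over this block fading channel, is the quantity $$P_f(\rho)=1-\mathbb{E}\left[\left(\frac{\sum_{k=0}^N (K-1)^k\sum_{|S|=k}J_S(H)}{K^N}\right)^L\right].$$ Let $W=\frac1N\sum_{i=1}^N\|v_i\|$ and $$R_k^2(H)=\begin{cases}\frac1\pi\,\Gamma\!\left(\frac k2+1\right)^{2/k}W^2\max_{i}\gamma_i, & 1\le k\le N-1,\\[2pt] \frac1\pi\,\Gamma\!\left(\frac N2+1\right)^{2/N}\left(\prod_{i=1}^N\gamma_i\right)^{1/N}, & k=N,\end{cases}$$ let $I_0(H)=1$ and, for $1\le k\le N$, let $$I_k(H)=\int_{\{z\in\mathbb{R}^k:\ \|z\|\le R_k(H)\}}(2\pi\sigma^2)^{-k/2}e^{-\|z\|^2/(2\sigma^2)}\,dz .$$ Then both expectations (the one in $P_f$ and the one below) are of integrable random variables, and $$P_{mslb}(\rho):=1-\mathbb{E}\left[\left(\frac{\sum_{k=0}^N (K-1)^k\binom Nk I_k(H)}{K^N}\right)^L\right]\ \le\ P_f(\rho).$$ -/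

import Mathlib

open MeasureTheory ProbabilityTheory

noncomputable section

/-- The Nakagami-`m` probability density (normalised so that the mean square is one):
`2 m ^ m x ^ (2 m - 1) exp (- m x ^ 2) / Γ(m)` for `x > 0`, and `0` otherwise. -/
def nakagamiPDF (m x : ℝ) : ℝ :=
  if 0 < x then 2 * m ^ m * x ^ (2 * m - 1) / Real.Gamma m * Real.exp (-m * x ^ 2) else 0

/-- The Nakagami-`m` distribution on the real line. -/
def nakagamiMeasure (m : ℝ) : Measure ℝ :=
  volume.withDensity fun x => ENNReal.ofReal (nakagamiPDF m x)

/-- The basis vectors of the faded lattice: the `i`-th column of `diag(h) * M`. With `h = 1`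
these are the basis vectors of the lattice itself. -/
def fadedVec {N : ℕ} (M : Matrix (Fin N) (Fin N) ℝ) (h : Fin N → ℝ) (i : Fin N) :
    EuclideanSpace ℝ (Fin N) :=
  WithLp.toLp 2 ((Matrix.diagonal h * M).col i)

/-- The real subspace spanned by the vectors `b i`, `i ∈ S`. -/
abbrev subSpan {N : ℕ} (b : Fin N → EuclideanSpace ℝ (Fin N)) (S : Finset (Fin N)) :
    Submodule ℝ (EuclideanSpace ℝ (Fin N)) :=
  Submodule.span ℝ (b '' (S : Set (Fin N)))

/-- The lattice of integer combinations of the vectors `b i`, `i ∈ S`. -/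
def subLattice {N : ℕ} (b : Fin N → EuclideanSpace ℝ (Fin N)) (S : Finset (Fin N)) :
    Submodule ℤ (EuclideanSpace ℝ (Fin N)) :=
  Submodule.span ℤ (b '' (S : Set (Fin N)))

/-- The Voronoi cell (around the origin) of the sublattice generated by `b i`, `i ∈ S`, as a
subset of the subspace that this sublattice spans. -/
def voronoiCell {N : ℕ} (b : Fin N → EuclideanSpace ℝ (Fin N)) (S : Finset (Fin N)) :
    Set (subSpan b S) :=
  {x | ∀ v ∈ subLattice b S,
    ‖(x : EuclideanSpace ℝ (Fin N))‖ ≤ ‖(x : EuclideanSpace ℝ (Fin N)) - v‖}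

/-- Lebesgue measure on a linear subspace (unit cubes of an orthonormal basis have mass one).
The `volume` of the subtype is not used: it would be the restriction of the ambient volume. -/
def subspaceVolume {N : ℕ} (U : Submodule ℝ (EuclideanSpace ℝ (Fin N))) : Measure U :=
  (stdOrthonormalBasis ℝ U).toBasis.addHaar

/-- The density, at a point of norm `r`, of `k`-dimensional white Gaussian noise of variance
`σ ^ 2 = 1 / ρ` per coordinate. -/
def noiseDensity (k : ℕ) (ρ r : ℝ) : ℝ :=
  (2 * Real.pi * (1 / ρ)) ^ (-(k : ℝ) / 2) * Real.exp (-(r ^ 2) / (2 * (1 / ρ)))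

/-- `J_S(H)`: the integral of the noise density over the faded Voronoi cell of the sublattice
given by the set `S` of basis vectors; it is `1` for the empty set. -/
def cellMass {N : ℕ} (M : Matrix (Fin N) (Fin N) ℝ) (ρ : ℝ) (S : Finset (Fin N))
    (h : Fin N → ℝ) : ℝ :=
  if S = ∅ then 1
  else ∫ z in voronoiCell (fadedVec M h) S, noiseDensity S.card ρ ‖z‖
    ∂(subspaceVolume (subSpan (fadedVec M h) S))

/-- Probability of correct reception of one symbol of the `K`-PAM constellation, for a given
channel realisation `h`:
`(∑ k, (K - 1) ^ k * ∑ (S with k elements), J_S(H)) / K ^ N`. -/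
def correctProb {N : ℕ} (M : Matrix (Fin N) (Fin N) ℝ) (K : ℕ) (ρ : ℝ) (h : Fin N → ℝ) : ℝ :=
  (∑ k ∈ Finset.range (N + 1), ((K : ℝ) - 1) ^ k *
    ∑ S ∈ Finset.powersetCard k (Finset.univ : Finset (Fin N)), cellMass M ρ S h) / (K : ℝ) ^ N

/-- The frame error probability of the `K`-PAM constellation, with frames of `L` symbols and
random fading coefficients `h`. -/
def frameErrorProb {Ω : Type*} [MeasurableSpace Ω] (P : Measure Ω) {N : ℕ}
    (M : Matrix (Fin N) (Fin N) ℝ) (K L : ℕ) (ρ : ℝ) (h : Fin N → Ω → ℝ) : ℝ :=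
  1 - ∫ ω, correctProb M K ρ (fun i => h i ω) ^ L ∂P

/-- `W`: the mean of the norms of the (unfaded) basis vectors, the columns of `M`. -/
def meanNorm {N : ℕ} (M : Matrix (Fin N) (Fin N) ℝ) : ℝ :=
  (∑ i, ‖(WithLp.toLp 2 (M.col i) : EuclideanSpace ℝ (Fin N))‖) / N

/-- The squared radius `R_k ^ 2(H)`, for `1 ≤ k ≤ N`, with power gains `γ i = h i ^ 2`. -/
def radiusSq {N : ℕ} (M : Matrix (Fin N) (Fin N) ℝ) (k : ℕ) (h : Fin N → ℝ) : ℝ :=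
  1 / Real.pi * Real.Gamma ((k : ℝ) / 2 + 1) ^ (2 / (k : ℝ)) *
    if k < N then meanNorm M ^ 2 * ⨆ i, h i ^ 2
    else (∏ i, h i ^ 2) ^ (1 / (N : ℝ))

/-- `I_k(H)`: the integral of the noise density over the `k`-dimensional ball of radius
`R_k(H)`; it is `1` for `k = 0`. -/
def ballMass {N : ℕ} (M : Matrix (Fin N) (Fin N) ℝ) (ρ : ℝ) (k : ℕ) (h : Fin N → ℝ) : ℝ :=
  if k = 0 then 1
  else ∫ z in Metric.closedBall (0 : EuclideanSpace ℝ (Fin k)) (√(radiusSq M k h)),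
    noiseDensity k ρ ‖z‖

/-- `(∑ k, (K - 1) ^ k * (N choose k) * I_k(H)) / K ^ N`. -/
def sphereProb {N : ℕ} (M : Matrix (Fin N) (Fin N) ℝ) (K : ℕ) (ρ : ℝ) (h : Fin N → ℝ) : ℝ :=
  (∑ k ∈ Finset.range (N + 1), ((K : ℝ) - 1) ^ k * (N.choose k : ℝ) * ballMass M ρ k h) /
    (K : ℝ) ^ N

/-- The multiple sphere lower bound. -/
def multipleSphereLowerBound {Ω : Type*} [MeasurableSpace Ω] (P : Measure Ω) {N : ℕ}
    (M : Matrix (Fin N) (Fin N) ℝ) (K L : ℕ) (ρ : ℝ) (h : Fin N → Ω → ℝ) : ℝ :=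
  1 - ∫ ω, sphereProb M K ρ (fun i => h i ω) ^ L ∂P

end

/-! For a fixed channel with nonzero gains, the Voronoi cell of each faded sublattice has volume at
most `gramVol`, because its lattice translates overlap only in null sets (`volume_closestCell_le`).
The noise density decreases with the norm. Subtracting its value on a sphere therefore gives a
bathtub inequality: the mass of a cell exceeds that of the ball by at most this value times the
excess volume (`setIntegral_noiseDensity_le_closedBall`).

This error is linear in the volume, so for fixed `k` it may be summed over all `S` with `k`
elements. The sum is nonpositive as soon as the ball has at least the mean volume
(`sum_gramVol_fadedVec_le`). For `k < N` that follows from Hadamard's inequality and Maclaurin's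
inequality for the norms of the columns; for `k = N` the volumes agree.

Nakagami gains are almost surely positive, so the bound holds almost surely and survives `L`-th
powers and expectation. `sphereProb` is bounded and dominates `correctProb`; measurability of the
latter comes from writing the cell integrals in lattice coordinates. -/

/-! ### Maclaurin's inequality for elementary symmetric sums. -/

/-- The sum of the `k`-fold products of nonnegative numbers is at most the value it takes when all
the numbers are replaced by their mean. -/
theorem sum_powersetCard_prod_le {ι : Type*} (s : Finset ι) (a : ι → ℝ)
    (ha : ∀ i, 0 ≤ a i) (k : ℕ) :
    ∑ t ∈ s.powersetCard k, ∏ i ∈ t, a i ≤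
      (s.card.choose k : ℝ) * ((∑ i ∈ s, a i) / s.card) ^ k := by
  classical
  induction s using Finset.induction_on generalizing k with
  | empty =>
    cases k with
    | zero => simp
    | succ k => rw [Finset.powersetCard_eq_empty.2 (by simp)]; simp
  | insert j s hj ih =>
    cases k with
    | zero => simp
    | succ k =>
      have hinj : Set.InjOn (insert j) (s.powersetCard k : Set (Finset ι)) := by
        intro t ht u hu h
        have ht' : j ∉ t := fun h => hj ((Finset.mem_powersetCard.1 ht).1 h)
        have hu' : j ∉ u := fun h => hj ((Finset.mem_powersetCard.1 hu).1 h)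
        rw [← Finset.erase_insert ht', h, Finset.erase_insert hu']
      have hdisj : Disjoint (s.powersetCard (k + 1)) ((s.powersetCard k).image (insert j)) := by
        rw [Finset.disjoint_left]
        intro t ht hu
        obtain ⟨u, -, rfl⟩ := Finset.mem_image.1 hu
        exact hj ((Finset.mem_powersetCard.1 ht).1 (Finset.mem_insert_self _ _))
      have hprod : ∀ t ∈ s.powersetCard k, ∏ i ∈ insert j t, a i = a j * ∏ i ∈ t, a i := by
        intro t ht
        exact Finset.prod_insert fun h => hj ((Finset.mem_powersetCard.1 ht).1 h)
      rw [Finset.powersetCard_succ_insert hj, Finset.sum_union hdisj,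
        Finset.sum_image hinj, Finset.sum_congr rfl hprod, ← Finset.mul_sum,
        Finset.sum_insert hj, Finset.card_insert_of_notMem hj]
      have h1 := ih (k + 1)
      have h2 := mul_le_mul_of_nonneg_left (ih k) (ha j)
      set n := s.card with hn
      set x := (∑ i ∈ s, a i) / n with hx
      have hx0 : 0 ≤ x := div_nonneg (Finset.sum_nonneg fun i _ => ha i) (Nat.cast_nonneg _)
      have hsum : ∑ i ∈ s, a i = n * x := by
        rcases Nat.eq_zero_or_pos n with h0 | h0
        · have hs : s = ∅ := Finset.card_eq_zero.1 (hn ▸ h0)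
          rw [h0, hs, Finset.sum_empty, Nat.cast_zero, zero_mul]
        · rw [hx]; field_simp
      rw [hsum]
      set y := (a j + n * x) / ((n + 1 : ℕ) : ℝ) with hy
      have hy0 : 0 ≤ y := 
        div_nonneg (add_nonneg (ha j) (mul_nonneg (Nat.cast_nonneg _) hx0)) (Nat.cast_nonneg _)
      have hya : a j = (n + 1) * y - n * x := by rw [hy]; push_cast; field_simp; ring
      -- The tangent to `t ^ (k + 1)` at the old mean `x`, evaluated at the new mean `y`. As `a j -
      -- x = (n + 1) * (y - x)`, multiplying the left side by `(n + 1).choose (k + 1)` gives exactly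
      -- the bound supplied by induction.
      have htan : x ^ (k + 1) + (k + 1) * x ^ k * (y - x) ≤ y ^ (k + 1) := by
        rcases hx0.eq_or_lt with h0 | h0
        · rw [← h0]
          rcases Nat.eq_zero_or_pos k with rfl | hk
          · simp
          · simp [hk.ne']; positivity
        -- Bernoulli's inequality, to be scaled by `x ^ (k + 1)`.
        · have hb := one_add_mul_le_pow (a := y / x - 1)
            (by have : 0 ≤ y / x := by positivity
                linarith) (k + 1)
          have := mul_le_mul_of_nonneg_left hb (pow_nonneg hx0 (k + 1))
          rw [← mul_pow] at this
          calc _ = x ^ (k + 1) * (1 + ((k + 1 : ℕ) : ℝ) * (y / x - 1)) := by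
                push_cast; field_simp; ring
            _ ≤ _ := this
            _ = _ := by congr 1; field_simp; ring
      have hc : ((n + 1).choose (k + 1) : ℝ) = n.choose k + n.choose (k + 1) := by
        exact_mod_cast Nat.choose_succ_succ n k
      have hc2 : ((n : ℝ) + 1) * n.choose k = (n + 1).choose (k + 1) * (k + 1) := by
        exact_mod_cast Nat.add_one_mul_choose_eq n k
      have h3 := mul_le_mul_of_nonneg_left htan (Nat.cast_nonneg (α := ℝ) ((n + 1).choose (k + 1)))
      refine le_trans (add_le_add h1 h2) (le_trans (le_of_eq ?_) h3)
      rw [hya, mul_add]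
      have : (((n + 1).choose (k + 1) : ℕ) : ℝ) * ((k + 1) * x ^ k * (y - x)) =
        ((n : ℝ) + 1) * n.choose k * (x ^ k * (y - x)) := by rw [hc2]; ring
      rw [this, hc]; ring

/-! ### Gram volumes and lattice cells in a Euclidean space. -/

section Gram

open Module Pointwise

variable {F : Type*} [NormedAddCommGroup F] [InnerProductSpace ℝ F] {ι : Type*} [Fintype ι]

/-- The square root of the determinant of the Gram matrix: the volume of the parallelepiped
spanned by `v` in the subspace spanned by `v`. -/
noncomputable def gramVol [DecidableEq ι] (v : ι → F) : ℝ := √(Matrix.gram ℝ v).det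

theorem abs_det_eq_gramVol [DecidableEq ι] (e : OrthonormalBasis ι ℝ F) (v : ι → F) :
    |e.toBasis.det v| = gramVol v := by
  have h := Matrix.gram_eq_conjTranspose_mul e v
  have h2 : (Matrix.of fun i j ↦ e.repr (v j) i) = e.toBasis.toMatrix v := by
    ext i j; simp [Basis.toMatrix_apply]
  rw [h2] at h
  rw [gramVol, h, Matrix.det_mul, Matrix.det_conjTranspose, Basis.det_apply, star_trivial,
    Real.sqrt_mul_self_eq_abs]

/-- Hadamard's inequality. -/
theorem gramVol_le_prod_norm [DecidableEq ι] [LinearOrder ι] [LocallyFiniteOrderBot ι]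
    [FiniteDimensional ℝ F] (hd : finrank ℝ F = Fintype.card ι) (v : ι → F) :
    gramVol v ≤ ∏ i, ‖v i‖ := by
  -- In the Gram–Schmidt basis the coordinate matrix is triangular with diagonal entries `⟪b i, v
  -- i⟫`.
  let b := InnerProductSpace.gramSchmidtOrthonormalBasis hd v
  rw [← abs_det_eq_gramVol b v, InnerProductSpace.gramSchmidtOrthonormalBasis_det hd v,
    Finset.abs_prod]
  refine Finset.prod_le_prod (fun i _ => abs_nonneg _) fun i _ => ?_
  have := abs_real_inner_le_norm (b i) (v i)
  rwa [b.norm_eq_one, one_mul] at this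

/-- The points which are at least as close to the origin as to the other points of the lattice
generated by `v`. -/
def closestCell (v : ι → F) : Set F :=
  {x | ∀ n : ι → ℤ, ‖x‖ ≤ ‖x - ∑ i, (n i : ℝ) • v i‖}

/-- The generators may vary with a parameter, so that closedness holds jointly in channel and point,
as measurability in the channel requires. -/
theorem isClosed_setOf_mem_closestCell {X : Type*} [TopologicalSpace X] {v : X → ι → F} {x : X → F}
    (hv : ∀ i, Continuous fun p => v p i) (hx : Continuous x) :
    IsClosed {p | x p ∈ closestCell (v p)} := by
  have : {p | x p ∈ closestCell (v p)} =
      ⋂ n : ι → ℤ, {p | ‖x p‖ ≤ ‖x p - ∑ i, (n i : ℝ) • v p i‖} := by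
    ext; simp [closestCell]
  rw [this]
  exact isClosed_iInter fun n => isClosed_le (by fun_prop) (by fun_prop)

theorem isClosed_closestCell (v : ι → F) : IsClosed (closestCell v) :=
  isClosed_setOf_mem_closestCell (fun _ => continuous_const) continuous_id

variable [FiniteDimensional ℝ F] [MeasurableSpace F] [BorelSpace F]

theorem volume_parallelepiped_eq_gramVol [DecidableEq ι] (hd : finrank ℝ F = Fintype.card ι)
    (v : ι → F) : volume (parallelepiped v) = ENNReal.ofReal (gramVol v) := by
  let e : OrthonormalBasis ι ℝ F := (stdOrthonormalBasis ℝ F).reindex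
    (Fintype.equivOfCardEq (by simpa using hd))
  rw [← e.addHaar_eq_volume, Measure.addHaar_parallelepiped, abs_det_eq_gramVol]

/-- Change of variables to lattice coordinates: the domain `ι → ℝ` no longer depends on the basis.
-/
theorem volume_eq_gramVol_smul_map [DecidableEq ι] (v : Basis ι ℝ F) :
    (volume : Measure F) = ENNReal.ofReal (gramVol v) •
      Measure.map (fun c : ι → ℝ => ∑ i, c i • v i) volume := by
  have h1 : (volume : Measure F) = ENNReal.ofReal (gramVol v) • v.addHaar := by
    rw [← volume_parallelepiped_eq_gramVol (finrank_eq_card_basis v), Basis.addHaar]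
    exact Measure.addHaarMeasure_unique _ v.parallelepiped
  have h2 : (volume : Measure (ι → ℝ)) = (Pi.basisFun ℝ ι).addHaar := by
    rw [Basis.addHaar, Basis.parallelepiped_basisFun, addHaarMeasure_eq_volume_pi]
  have h3 : (fun c : ι → ℝ => ∑ i, c i • v i) =
      v.equivFun.symm.toContinuousLinearEquiv := by
    ext c; simp [Basis.equivFun_symm_apply]
  have h4 : (Pi.basisFun ℝ ι).map v.equivFun.symm.toContinuousLinearEquiv.toLinearEquiv = v := by
    ext i; simp [Basis.equivFun_symm_apply, Pi.single_apply]
  rw [h2, h3, Basis.map_addHaar, h4]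
  exact h1

theorem volume_setOf_norm_eq_norm_sub {w : F} (hw : w ≠ 0) :
    volume {x : F | ‖x‖ = ‖x - w‖} = 0 := by
  have : {x : F | ‖x‖ = ‖x - w‖} = (AffineSubspace.perpBisector (0 : F) w : Set F) := by
    ext x; simp [AffineSubspace.mem_perpBisector_iff_dist_eq, dist_eq_norm]
  rw [this]
  exact Measure.addHaar_affineSubspace _ _ (by simpa using hw.symm)

/-- The lattice translates of the cell form a packing up to null sets, so the cell is no larger than
a fundamental domain. That they also cover the space is not needed. -/
theorem volume_closestCell_le [DecidableEq ι] (v : Basis ι ℝ F) :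
    volume (closestCell v) ≤ ENNReal.ofReal (gramVol v) := by
  have hmem : ∀ w : Submodule.span ℤ (Set.range v), ∃ n : ι → ℤ,
      ∑ i, (n i : ℝ) • v i = (w : F) := by
    intro w
    obtain ⟨n, hn⟩ := (Submodule.mem_span_range_iff_exists_fun ℤ).1 w.2
    exact ⟨n, by simpa [Int.cast_smul_eq_zsmul] using hn⟩
  have hle : ∀ (w : Submodule.span ℤ (Set.range v)) (x : F), x ∈ closestCell v →
      ‖x‖ ≤ ‖x - w‖ := by
    intro w x hx
    obtain ⟨n, hn⟩ := hmem w
    exact hn ▸ hx n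
  have hdis : ∀ g h : Submodule.span ℤ (Set.range v), g ≠ h →
      volume ((g +ᵥ closestCell v) ∩ (h +ᵥ closestCell v)) = 0 := by
    intro g h hgh
    have hsub : (g +ᵥ closestCell v) ∩ (h +ᵥ closestCell v) ⊆
        (fun x : F => x - g) ⁻¹' {x : F | ‖x‖ = ‖x - ((h : F) - g)‖} := by
      rintro x ⟨⟨y, hy, rfl⟩, ⟨z, hz, hzy⟩⟩
      have e : (h : F) + z = g + y := hzy
      -- A common point is `g + y = h + z` with `y`, `z` in the cell. They differ by a lattice
      -- vector, so each norm bounds the other and `y` lies on a perpendicular bisector.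
      have h1 := hle (h - g) y hy
      have h2 := hle (g - h) z hz
      have e1 : y - ((h - g : Submodule.span ℤ (Set.range v)) : F) = z := by
        rw [Submodule.coe_sub, sub_sub_eq_add_sub, add_comm y, ← e]; abel
      have e2 : z - ((g - h : Submodule.span ℤ (Set.range v)) : F) = y := by
        rw [Submodule.coe_sub, sub_sub_eq_add_sub, add_comm z, e]; abel
      rw [e1] at h1
      rw [e2] at h2
      rw [Submodule.coe_sub] at e1
      change ‖(g : F) + y - g‖ = ‖(g : F) + y - g - ((h : F) - g)‖
      rw [add_sub_cancel_left, e1]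
      exact le_antisymm h1 h2
    refine measure_mono_null hsub ?_
    simp only [sub_eq_add_neg]
    rw [measure_preimage_add_right]
    simp only [← sub_eq_add_neg]
    exact volume_setOf_norm_eq_norm_sub (sub_ne_zero.2 fun e => hgh (Subtype.ext e.symm))
  have hfd := ZSpan.isAddFundamentalDomain' v volume
  have hcl : volume (closestCell v) ≤ volume (ZSpan.fundamentalDomain v) := by
    have : Countable (Submodule.span ℤ (Set.range v)).toAddSubgroup :=
      inferInstanceAs (Countable (Submodule.span ℤ (Set.range v)))
    refine hfd.measure_le_of_pairwise_disjoint
      (isClosed_closestCell _).measurableSet.nullMeasurableSet fun g h hgh => ?_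
    exact measure_mono_null (Set.inter_subset_inter Set.inter_subset_left Set.inter_subset_left)
      (hdis g h hgh)
  refine hcl.trans ?_
  let e : OrthonormalBasis ι ℝ F := (stdOrthonormalBasis ℝ F).reindex
    (Fintype.equivOfCardEq (by simpa using finrank_eq_card_basis v))
  rw [ZSpan.measure_fundamentalDomain v volume e.toBasis, abs_det_eq_gramVol]
  rw [measure_congr (ZSpan.fundamentalDomain_ae_parallelepiped e.toBasis volume)]
  have := e.volume_parallelepiped
  simp_all

end Gram

/-! ### Gaussian noise on cells and balls. -/

section Noise

open Module

theorem noiseDensity_nonneg (k : ℕ) {ρ : ℝ} (hρ : 0 < ρ) (r : ℝ) : 0 ≤ noiseDensity k ρ r := by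
  have := Real.pi_pos
  unfold noiseDensity
  positivity

theorem noiseDensity_le_of_le (k : ℕ) {ρ : ℝ} (hρ : 0 < ρ) {r s : ℝ} (hr : 0 ≤ r) (hrs : r ≤ s) :
    noiseDensity k ρ s ≤ noiseDensity k ρ r := by
  have := Real.pi_pos
  unfold noiseDensity
  gcongr

theorem continuous_noiseDensity (k : ℕ) (ρ : ℝ) : Continuous (noiseDensity k ρ) := by
  unfold noiseDensity
  fun_prop

variable {F : Type*} [NormedAddCommGroup F] [InnerProductSpace ℝ F]
  [FiniteDimensional ℝ F] [MeasurableSpace F] [BorelSpace F]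

theorem integrable_noiseDensity_norm (k : ℕ) {ρ : ℝ} (hρ : 0 < ρ) :
    Integrable (fun z : F => noiseDensity k ρ ‖z‖) := by
  have hb : 0 < ((1 / (2 * (1 / ρ)) : ℝ) : ℂ).re := by rw [Complex.ofReal_re]; positivity
  have h := (GaussianFourier.integrable_cexp_neg_mul_sq_norm_add (V := F) hb 0 0).norm
  refine (h.const_mul ((2 * Real.pi * (1 / ρ)) ^ (-(k : ℝ) / 2))).congr (.of_forall fun z => ?_)
  simp only [noiseDensity, Complex.norm_exp, zero_mul, add_zero]
  congr 2
  rw [← Complex.ofReal_pow, ← Complex.ofReal_neg, ← Complex.ofReal_mul, Complex.ofReal_re]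
  ring

/-- Among all sets, the noise favours balls: the excess mass of a set over a ball is at most the
excess volume times the density on the sphere. -/
theorem setIntegral_noiseDensity_le_closedBall (k : ℕ) {ρ : ℝ} (hρ : 0 < ρ) {R : ℝ} (hR : 0 ≤ R)
    {V : Set F} (hV : MeasurableSet V) (hfin : volume V ≠ ⊤) :
    ∫ z in V, noiseDensity k ρ ‖z‖ ≤ (∫ z in Metric.closedBall (0 : F) R, noiseDensity k ρ ‖z‖) +
      noiseDensity k ρ R * (volume.real V - volume.real (Metric.closedBall (0 : F) R)) := by
  have hint := integrable_noiseDensity_norm (F := F) k hρ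
  have hballm : MeasurableSet (Metric.closedBall (0 : F) R) := measurableSet_closedBall
  have hballf : volume (Metric.closedBall (0 : F) R) ≠ ⊤ := measure_closedBall_lt_top.ne
  have key : ∀ A : Set F, MeasurableSet A → volume A ≠ ⊤ →
      Integrable (A.indicator fun z => noiseDensity k ρ ‖z‖ - noiseDensity k ρ R) ∧
      ∫ z, A.indicator (fun z => noiseDensity k ρ ‖z‖ - noiseDensity k ρ R) z =
        (∫ z in A, noiseDensity k ρ ‖z‖) - noiseDensity k ρ R * volume.real A := by
    intro A hA hAf
    have hc : IntegrableOn (fun _ : F => noiseDensity k ρ R) A := integrableOn_const hAf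
    refine ⟨(integrable_indicator_iff hA).2 (hint.integrableOn.sub hc), ?_⟩
    rw [integral_indicator hA, integral_sub hint.integrableOn hc, setIntegral_const, smul_eq_mul,
      mul_comm]
  obtain ⟨i1, e1⟩ := key V hV hfin
  obtain ⟨i2, e2⟩ := key _ hballm hballf
  -- The density minus its value at radius `R` is nonnegative on the ball and nonpositive off it, so
  -- the indicator of the ball is pointwise the best one.
  have hmono := integral_mono i1 i2 fun z => ?_
  · rw [e1, e2] at hmono
    linarith
  · by_cases hz : z ∈ Metric.closedBall (0 : F) R
    · have hz' : ‖z‖ ≤ R := by simpa using hz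
      have := noiseDensity_le_of_le k hρ (norm_nonneg z) hz'
      rw [Set.indicator_of_mem hz]
      exact Set.indicator_apply_le' (fun _ => le_rfl) fun _ => sub_nonneg.2 this
    · have hz' : R < ‖z‖ := by simpa using hz
      have := noiseDensity_le_of_le k hρ hR hz'.le
      rw [Set.indicator_of_notMem hz]
      exact Set.indicator_apply_le' (fun _ => sub_nonpos.2 this) fun _ => le_rfl

variable {ι : Type*} [Fintype ι] [DecidableEq ι]

/-- An isometry moves the ball to the model space, so one ball serves all spans of dimension `k`.
The radius is free, not fitted to the cell. -/
theorem setIntegral_closestCell_le (v : Basis ι ℝ F) (k : ℕ) (hk : Fintype.card ι = k) {ρ : ℝ}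
    (hρ : 0 < ρ) {R : ℝ} (hR : 0 ≤ R) :
    ∫ z in closestCell v, noiseDensity k ρ ‖z‖ ≤
      (∫ z in Metric.closedBall (0 : EuclideanSpace ℝ (Fin k)) R, noiseDensity k ρ ‖z‖) +
      noiseDensity k ρ R *
        (gramVol v - volume.real (Metric.closedBall (0 : EuclideanSpace ℝ (Fin k)) R)) := by
  let f : F ≃ₗᵢ[ℝ] EuclideanSpace ℝ (Fin k) := ((stdOrthonormalBasis ℝ F).reindex
    (finCongr ((finrank_eq_card_basis v).trans hk))).repr
  have hpre : f ⁻¹' Metric.closedBall (0 : EuclideanSpace ℝ (Fin k)) R =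
      Metric.closedBall (0 : F) R := by
    ext; simp
  have hvol := volume_closestCell_le v
  have hfin : volume (closestCell v) ≠ ⊤ := (hvol.trans_lt ENNReal.ofReal_lt_top).ne
  have hreal : volume.real (closestCell v) ≤ gramVol v :=
    ENNReal.toReal_le_of_le_ofReal (Real.sqrt_nonneg _) hvol
  have hball : volume.real (Metric.closedBall (0 : F) R) =
      volume.real (Metric.closedBall (0 : EuclideanSpace ℝ (Fin k)) R) := by
    rw [← hpre, Measure.real, Measure.real,
      f.measurePreserving.measure_preimage measurableSet_closedBall.nullMeasurableSet]
  have hint : ∫ z in Metric.closedBall (0 : F) R, noiseDensity k ρ ‖z‖ =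
      ∫ z in Metric.closedBall (0 : EuclideanSpace ℝ (Fin k)) R, noiseDensity k ρ ‖z‖ := by
    rw [← hpre, ← f.measurePreserving.setIntegral_preimage_emb
      f.toHomeomorph.measurableEmbedding]
    simp
  have h := setIntegral_noiseDensity_le_closedBall k hρ hR
    (isClosed_closestCell (v : ι → F)).measurableSet hfin
  rw [hball, hint] at h
  refine h.trans ?_
  have := noiseDensity_nonneg k hρ R
  gcongr

theorem setIntegral_closestCell_eq (v : Basis ι ℝ F) (g : F → ℝ) (hg : Continuous g) :
    ∫ z in closestCell v, g z = gramVol v *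
      ∫ c in {c : ι → ℝ | ∑ i, c i • v i ∈ closestCell v}, g (∑ i, c i • v i) := by
  have hm : MeasurableSet (closestCell v) := (isClosed_closestCell _).measurableSet
  have hf : Measurable fun c : ι → ℝ => ∑ i, c i • v i := by fun_prop
  rw [volume_eq_gramVol_smul_map v, Measure.restrict_smul, integral_smul_measure,
    setIntegral_map hm hg.aestronglyMeasurable hf.aemeasurable,
    ENNReal.toReal_ofReal (show 0 ≤ gramVol v from Real.sqrt_nonneg _), smul_eq_mul]
  rfl

end Noise

/-! ### Faded sublattices and their cell masses. -/

section Faded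

variable {N : ℕ}

/-- The vectors `b i`, `i ∈ S`, as a basis of the subspace they span. -/
noncomputable def subSpanBasis (b : Fin N → EuclideanSpace ℝ (Fin N)) (hb : LinearIndependent ℝ b)
    (S : Finset (Fin N)) : Module.Basis S ℝ (subSpan b S) :=
  (Module.Basis.span (hb.comp ((↑) : S → Fin N) Subtype.val_injective)).map
    (LinearEquiv.ofEq _ _ (by rw [Set.range_comp, subSpan]; simp))

@[simp]
theorem coe_subSpanBasis (b : Fin N → EuclideanSpace ℝ (Fin N)) (hb : LinearIndependent ℝ b)
    (S : Finset (Fin N)) (i : S) : (subSpanBasis b hb S i : EuclideanSpace ℝ (Fin N)) = b i := by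
  simp [subSpanBasis, Module.Basis.span_apply]

theorem voronoiCell_eq_closestCell (b : Fin N → EuclideanSpace ℝ (Fin N))
    (hb : LinearIndependent ℝ b) (S : Finset (Fin N)) :
    voronoiCell b S = closestCell (subSpanBasis b hb S) := by
  ext x
  have hr : b '' (S : Set (Fin N)) = Set.range fun i : S => b i := by
    ext; simp
  have hc : ∀ n : S → ℤ, ‖x - ∑ i, (n i : ℝ) • subSpanBasis b hb S i‖ =
      ‖(x : EuclideanSpace ℝ (Fin N)) - ∑ i : S, n i • b i‖ := by
    intro n
    rw [Submodule.coe_norm]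
    simp [Int.cast_smul_eq_zsmul]
  simp only [voronoiCell, closestCell, subLattice, hr, Set.mem_ofPred_eq, hc,
    Submodule.mem_span_range_iff_exists_fun]
  constructor
  · intro h n
    exact h _ ⟨n, rfl⟩
  · rintro h _ ⟨n, rfl⟩
    exact h n

theorem gramVol_subSpanBasis (b : Fin N → EuclideanSpace ℝ (Fin N))
    (hb : LinearIndependent ℝ b) (S : Finset (Fin N)) :
    gramVol (subSpanBasis b hb S) = gramVol fun i : S => b i := by
  unfold gramVol Matrix.gram
  simp [Submodule.coe_inner]

theorem fadedVec_apply (M : Matrix (Fin N) (Fin N) ℝ) (h : Fin N → ℝ) (i j : Fin N) :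
    fadedVec M h i j = h j * M j i := by
  simp [fadedVec, Matrix.col_apply]

theorem linearIndependent_fadedVec {M : Matrix (Fin N) (Fin N) ℝ} (hM : M.det ≠ 0)
    {h : Fin N → ℝ} (hh : ∀ i, h i ≠ 0) : LinearIndependent ℝ (fadedVec M h) := by
  have hd : (Matrix.diagonal h * M).det ≠ 0 := by
    rw [Matrix.det_mul, Matrix.det_diagonal]
    exact mul_ne_zero (Finset.prod_ne_zero_iff.2 fun i _ => hh i) hM
  have := Matrix.linearIndependent_cols_of_det_ne_zero hd
  exact this.map' (WithLp.linearEquiv 2 ℝ (Fin N → ℝ)).symm.toLinearMap (LinearEquiv.ker _)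

theorem continuous_fadedVec (M : Matrix (Fin N) (Fin N) ℝ) (i : Fin N) :
    Continuous fun h => fadedVec M h i := by
  have : (fun h => fadedVec M h i) = fun h => WithLp.toLp 2 fun j => h j * M j i := by
    ext h j; exact fadedVec_apply M h i j
  rw [this]
  fun_prop

theorem norm_fadedVec_le (M : Matrix (Fin N) (Fin N) ℝ) (h : Fin N → ℝ) (i : Fin N) :
    ‖fadedVec M h i‖ ≤ √(⨆ j, h j ^ 2) *
      ‖(WithLp.toLp 2 (M.col i) : EuclideanSpace ℝ (Fin N))‖ := by
  rw [EuclideanSpace.norm_eq, EuclideanSpace.norm_eq, ← Real.sqrt_mul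
    (Real.iSup_nonneg fun j => sq_nonneg _)]
  apply Real.sqrt_le_sqrt
  rw [Finset.mul_sum]
  refine Finset.sum_le_sum fun j _ => ?_
  rw [fadedVec_apply, norm_mul, mul_pow, Real.norm_eq_abs (h j), sq_abs]
  have : h j ^ 2 ≤ ⨆ j, h j ^ 2 := le_ciSup (f := fun j => h j ^ 2) (Finite.bddAbove_range _) j
  exact mul_le_mul_of_nonneg_right this (sq_nonneg _)

theorem gramVol_fadedVec_univ {M : Matrix (Fin N) (Fin N) ℝ} (hM : |M.det| = 1)
    (h : Fin N → ℝ) :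
    gramVol (fun i : (Finset.univ : Finset (Fin N)) => fadedVec M h i) = |∏ i, h i| := by
  have hg : (Matrix.gram ℝ fun i : (Finset.univ : Finset (Fin N)) => fadedVec M h i) =
      ((Matrix.diagonal h * M).transpose * (Matrix.diagonal h * M)).submatrix
        (Equiv.subtypeUnivEquiv Finset.mem_univ) (Equiv.subtypeUnivEquiv Finset.mem_univ) := by
    ext i j
    rw [Matrix.submatrix_apply, Matrix.mul_apply]
    simp [Matrix.gram, fadedVec_apply, PiLp.inner_apply, Matrix.diagonal_mul, mul_comm]
  rw [gramVol, hg, Matrix.det_submatrix_equiv_self, Matrix.det_mul, Matrix.det_transpose,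
    Real.sqrt_mul_self_eq_abs, Matrix.det_mul, Matrix.det_diagonal, abs_mul, hM, mul_one]

theorem cellMass_eq_setIntegral_closestCell (M : Matrix (Fin N) (Fin N) ℝ) (ρ : ℝ)
    {S : Finset (Fin N)} (hS : S ≠ ∅) {h : Fin N → ℝ}
    (hb : LinearIndependent ℝ (fadedVec M h)) :
    cellMass M ρ S h = ∫ z in closestCell (subSpanBasis (fadedVec M h) hb S),
      noiseDensity S.card ρ ‖z‖ ∂(subspaceVolume (subSpan (fadedVec M h) S)) := by
  rw [cellMass, if_neg hS, voronoiCell_eq_closestCell _ hb]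

theorem cellMass_le (M : Matrix (Fin N) (Fin N) ℝ) {ρ : ℝ} (hρ : 0 < ρ)
    {S : Finset (Fin N)} (hS : S ≠ ∅) {h : Fin N → ℝ}
    (hb : LinearIndependent ℝ (fadedVec M h)) {R : ℝ} (hR : 0 ≤ R) :
    cellMass M ρ S h ≤
      (∫ z in Metric.closedBall (0 : EuclideanSpace ℝ (Fin S.card)) R,
        noiseDensity S.card ρ ‖z‖) +
      noiseDensity S.card ρ R * (gramVol (fun i : S => fadedVec M h i) -
        volume.real (Metric.closedBall (0 : EuclideanSpace ℝ (Fin S.card)) R)) := by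
  rw [cellMass_eq_setIntegral_closestCell M ρ hS hb, ← gramVol_subSpanBasis _ hb]
  -- The inner product space volume in the general lemma is by definition `subspaceVolume`.
  exact setIntegral_closestCell_le (subSpanBasis (fadedVec M h) hb S) S.card (by simp) hρ hR

theorem cellMass_nonneg (M : Matrix (Fin N) (Fin N) ℝ) {ρ : ℝ} (hρ : 0 < ρ)
    (S : Finset (Fin N)) (h : Fin N → ℝ) : 0 ≤ cellMass M ρ S h := by
  unfold cellMass
  split_ifs
  · exact zero_le_one
  · exact integral_nonneg fun z => noiseDensity_nonneg _ hρ _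

/-- The span varies with `h`; in coordinates the integral lives on the fixed space `S → ℝ`, and the
right side makes sense for every channel. -/
theorem cellMass_eq_gramVol_mul (M : Matrix (Fin N) (Fin N) ℝ) (ρ : ℝ)
    {S : Finset (Fin N)} (hS : S ≠ ∅) {h : Fin N → ℝ}
    (hb : LinearIndependent ℝ (fadedVec M h)) :
    cellMass M ρ S h = gramVol (fun i : S => fadedVec M h i) *
      ∫ c in {c : S → ℝ | ∑ i, c i • fadedVec M h i ∈ closestCell fun i : S => fadedVec M h i},
        noiseDensity S.card ρ ‖∑ i, c i • fadedVec M h i‖ := by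
  rw [cellMass_eq_setIntegral_closestCell M ρ hS hb, ← gramVol_subSpanBasis _ hb]
  refine (setIntegral_closestCell_eq (subSpanBasis (fadedVec M h) hb S)
    (fun z => noiseDensity S.card ρ ‖z‖)
    ((continuous_noiseDensity _ _).comp continuous_norm)).trans ?_
  have hc : ∀ c : S → ℝ, ‖∑ i, c i • subSpanBasis (fadedVec M h) hb S i‖ =
      ‖∑ i : S, c i • fadedVec M h i‖ := by
    intro c
    rw [Submodule.coe_norm]
    simp
  have hset : {c : S → ℝ | ∑ i, c i • subSpanBasis (fadedVec M h) hb S i ∈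
      closestCell (subSpanBasis (fadedVec M h) hb S)} =
      {c : S → ℝ | ∑ i, c i • fadedVec M h i ∈ closestCell fun i : S => fadedVec M h i} := by
    ext c
    simp only [closestCell, Set.mem_ofPred_eq, ← Finset.sum_sub_distrib, ← sub_smul]
    simp only [hc]
  simp only [hc, hset]

theorem measurable_gramVol_mul_integral (M : Matrix (Fin N) (Fin N) ℝ) (ρ : ℝ)
    (S : Finset (Fin N)) :
    Measurable fun h : Fin N → ℝ => gramVol (fun i : S => fadedVec M h i) *
      ∫ c in {c : S → ℝ | ∑ i, c i • fadedVec M h i ∈ closestCell fun i : S => fadedVec M h i},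
        noiseDensity S.card ρ ‖∑ i, c i • fadedVec M h i‖ := by
  have hv := continuous_fadedVec M
  have hG : Continuous fun h : Fin N → ℝ => gramVol fun i : S => fadedVec M h i := by
    unfold gramVol
    refine Real.continuous_sqrt.comp (Continuous.matrix_det ?_)
    exact continuous_matrix fun i j => (hv i).inner (hv j)
  refine hG.measurable.mul ?_
  have hs : Continuous
      fun p : (Fin N → ℝ) × (S → ℝ) => ∑ i : S, p.2 i • fadedVec M p.1 i :=
    continuous_finsetSum _ fun i _ =>
      ((continuous_apply i).comp continuous_snd).smul ((hv i).comp continuous_fst)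
  -- The cells form a closed subset of channels times coordinates, so the integral over its sections
  -- is measurable in the channel.
  have hA := isClosed_setOf_mem_closestCell
    (v := fun (p : (Fin N → ℝ) × (S → ℝ)) (i : S) => fadedVec M p.1 i)
    (fun i => (hv i).comp continuous_fst) hs
  have hm := ((continuous_noiseDensity S.card ρ).comp hs.norm).stronglyMeasurable.indicator
      hA.measurableSet
  convert! (hm.integral_prod_right' (ν := volume)).measurable using 2 with h
  refine (integral_indicator ?_).symm
  exact (hA.preimage (Continuous.prodMk_right h)).measurableSet

end Faded

/-! ### Radii, mean volumes and the pointwise bound. -/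

section Radius

variable {N : ℕ}

/-- The Gamma and π factors are the squared radius of a ball of volume one, so they cancel. -/
theorem volumeReal_closedBall_sqrt {k : ℕ} (hk : k ≠ 0) (T : ℝ) :
    volume.real (Metric.closedBall (0 : EuclideanSpace ℝ (Fin k))
      √(1 / Real.pi * Real.Gamma ((k : ℝ) / 2 + 1) ^ (2 / (k : ℝ)) * T)) = √T ^ k := by
  have : NeZero k := ⟨hk⟩
  have hG : 0 < Real.Gamma ((k : ℝ) / 2 + 1) := Real.Gamma_pos_of_pos (by positivity)
  have hk' : (k : ℝ) ≠ 0 := Nat.cast_ne_zero.2 hk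
  have hroot : √(Real.Gamma ((k : ℝ) / 2 + 1) ^ (2 / (k : ℝ))) ^ k =
      Real.Gamma ((k : ℝ) / 2 + 1) := by
    rw [Real.sqrt_eq_rpow, ← Real.rpow_mul hG.le, ← Real.rpow_natCast, ← Real.rpow_mul hG.le,
      show 2 / (k : ℝ) * (1 / 2) * k = 1 by field_simp, Real.rpow_one]
  have hπ : 0 < √Real.pi := Real.sqrt_pos.2 Real.pi_pos
  rw [Measure.real, EuclideanSpace.volume_closedBall, Fintype.card_fin, ENNReal.toReal_mul,
    ENNReal.toReal_pow, ENNReal.toReal_ofReal (Real.sqrt_nonneg _),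
    ENNReal.toReal_ofReal (by positivity), Real.sqrt_mul (by positivity),
    Real.sqrt_mul (by positivity), mul_pow, mul_pow, hroot, Real.sqrt_div' _ Real.pi_pos.le,
    Real.sqrt_one, div_pow, one_pow]
  field_simp

theorem meanNorm_nonneg (M : Matrix (Fin N) (Fin N) ℝ) : 0 ≤ meanNorm M :=
  div_nonneg (Finset.sum_nonneg fun _ _ => norm_nonneg _) (Nat.cast_nonneg _)

/-- The balls of radius `R_k` have at least the mean volume of the parallelepipeds spanned by `k`
of the basis vectors. -/
theorem sum_gramVol_fadedVec_le {M : Matrix (Fin N) (Fin N) ℝ} (hM : |M.det| = 1)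
    {h : Fin N → ℝ} (hh : ∀ i, h i ≠ 0) {k : ℕ} (hk : k ≠ 0) (hkN : k ≤ N) :
    ∑ S ∈ Finset.powersetCard k (Finset.univ : Finset (Fin N)),
        gramVol (fun i : S => fadedVec M h i) ≤
      (N.choose k : ℝ) * volume.real
        (Metric.closedBall (0 : EuclideanSpace ℝ (Fin k)) √(radiusSq M k h)) := by
  have hsup : 0 ≤ ⨆ i, h i ^ 2 := Real.iSup_nonneg fun j => sq_nonneg _
  rcases hkN.lt_or_eq with hlt | rfl
  · have hb : LinearIndependent ℝ (fadedVec M h) :=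
      linearIndependent_fadedVec (fun h0 => by simp [h0] at hM) hh
    set a : Fin N → ℝ := fun i => ‖(WithLp.toLp 2 (M.col i) : EuclideanSpace ℝ (Fin N))‖ with ha
    have hS : ∀ S ∈ Finset.powersetCard k (Finset.univ : Finset (Fin N)),
        gramVol (fun i : S => fadedVec M h i) ≤ √(⨆ i, h i ^ 2) ^ k * ∏ i ∈ S, a i := by
      intro S hS
      rw [← gramVol_subSpanBasis _ hb]
      refine (gramVol_le_prod_norm
        (Module.finrank_eq_card_basis (subSpanBasis (fadedVec M h) hb S)) _).trans ?_
      rw [← (Finset.mem_powersetCard.1 hS).2, ← Finset.prod_const, ← Finset.prod_mul_distrib,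
        ← Finset.prod_coe_sort S]
      refine Finset.prod_le_prod (fun i _ => norm_nonneg _) fun i _ => ?_
      rw [Submodule.coe_norm, coe_subSpanBasis]
      exact norm_fadedVec_le M h i
    have hmac := sum_powersetCard_prod_le Finset.univ a (fun i => norm_nonneg _) k
    rw [Finset.card_univ, Fintype.card_fin] at hmac
    rw [radiusSq, if_pos hlt, volumeReal_closedBall_sqrt hk,
      Real.sqrt_mul (sq_nonneg _), Real.sqrt_sq (meanNorm_nonneg M)]
    calc _ ≤ _ := Finset.sum_le_sum hS
      _ = √(⨆ i, h i ^ 2) ^ k *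
          ∑ S ∈ Finset.powersetCard k (Finset.univ : Finset (Fin N)), ∏ i ∈ S, a i := by
        rw [Finset.mul_sum]
      _ ≤ √(⨆ i, h i ^ 2) ^ k * ((N.choose k : ℝ) * meanNorm M ^ k) := by
        exact mul_le_mul_of_nonneg_left hmac (by positivity)
      _ = _ := by ring
  -- For `k = N` there is a single subset, and both volumes equal `|∏ i, h i|`.
  · have hP : 0 ≤ ∏ i, h i ^ 2 := Finset.prod_nonneg fun i _ => sq_nonneg _
    have hps : Finset.powersetCard k (Finset.univ : Finset (Fin k)) = {Finset.univ} := by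
      simpa using Finset.powersetCard_self (Finset.univ : Finset (Fin k))
    have hk' : (k : ℝ) ≠ 0 := Nat.cast_ne_zero.2 hk
    rw [hps, Finset.sum_singleton, gramVol_fadedVec_univ hM, radiusSq, if_neg (lt_irrefl k),
      volumeReal_closedBall_sqrt hk, Nat.choose_self, Nat.cast_one, one_mul,
      Real.sqrt_eq_rpow, ← Real.rpow_mul hP, ← Real.rpow_natCast, ← Real.rpow_mul hP,
      show 1 / (k : ℝ) * (1 / 2) * k = 1 / 2 by field_simp, ← Real.sqrt_eq_rpow,
      Finset.prod_pow, Real.sqrt_sq_eq_abs]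

/-- A single cell may be larger than the ball, so the comparison is made only after summing over
`S`. The linear errors then add up to the density at `R` times a nonpositive difference of volumes.
-/
theorem sum_cellMass_le {M : Matrix (Fin N) (Fin N) ℝ} (hM : |M.det| = 1) {ρ : ℝ} (hρ : 0 < ρ)
    {h : Fin N → ℝ} (hh : ∀ i, h i ≠ 0) {k : ℕ} (hkN : k ≤ N) :
    ∑ S ∈ Finset.powersetCard k (Finset.univ : Finset (Fin N)), cellMass M ρ S h ≤
      (N.choose k : ℝ) * ballMass M ρ k h := by
  rcases eq_or_ne k 0 with rfl | hk
  · simp [cellMass, ballMass]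
  have hb : LinearIndependent ℝ (fadedVec M h) :=
    linearIndependent_fadedVec (fun h0 => by simp [h0] at hM) hh
  rw [ballMass, if_neg hk]
  set R := √(radiusSq M k h) with hR
  have hS : ∀ S ∈ Finset.powersetCard k (Finset.univ : Finset (Fin N)), cellMass M ρ S h ≤
      (∫ z in Metric.closedBall (0 : EuclideanSpace ℝ (Fin k)) R, noiseDensity k ρ ‖z‖) +
      noiseDensity k ρ R * (gramVol (fun i : S => fadedVec M h i) -
        volume.real (Metric.closedBall (0 : EuclideanSpace ℝ (Fin k)) R)) := by
    intro S hS
    obtain rfl := (Finset.mem_powersetCard.1 hS).2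
    exact cellMass_le M hρ (by rintro rfl; exact hk rfl) hb (Real.sqrt_nonneg _)
  refine (Finset.sum_le_sum hS).trans ?_
  rw [Finset.sum_add_distrib, ← Finset.mul_sum, Finset.sum_sub_distrib, Finset.sum_const,
    Finset.sum_const, Finset.card_powersetCard, Finset.card_univ, Fintype.card_fin,
    nsmul_eq_mul, nsmul_eq_mul]
  have h1 := sum_gramVol_fadedVec_le hM hh hk hkN
  have h2 := mul_nonneg (noiseDensity_nonneg k hρ R) (sub_nonneg.2 h1)
  linarith

theorem correctProb_nonneg (M : Matrix (Fin N) (Fin N) ℝ) {K : ℕ} (hK : 1 ≤ K) {ρ : ℝ}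
    (hρ : 0 < ρ) (h : Fin N → ℝ) : 0 ≤ correctProb M K ρ h := by
  have hK' : (0 : ℝ) ≤ K - 1 := sub_nonneg.2 (by exact_mod_cast hK)
  exact div_nonneg (Finset.sum_nonneg fun k _ => mul_nonneg (pow_nonneg hK' k)
    (Finset.sum_nonneg fun S _ => cellMass_nonneg M hρ S h)) (by positivity)

theorem correctProb_le_sphereProb {M : Matrix (Fin N) (Fin N) ℝ} (hM : |M.det| = 1) {K : ℕ}
    (hK : 1 ≤ K) {ρ : ℝ} (hρ : 0 < ρ) {h : Fin N → ℝ} (hh : ∀ i, h i ≠ 0) :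
    correctProb M K ρ h ≤ sphereProb M K ρ h := by
  have hK' : (0 : ℝ) ≤ K - 1 := sub_nonneg.2 (by exact_mod_cast hK)
  refine div_le_div_of_nonneg_right (Finset.sum_le_sum fun k hk => ?_) (by positivity)
  rw [mul_assoc]
  exact mul_le_mul_of_nonneg_left
    (sum_cellMass_le hM hρ hh (Nat.lt_succ_iff.1 (Finset.mem_range.1 hk))) (pow_nonneg hK' k)

theorem ballMass_nonneg (M : Matrix (Fin N) (Fin N) ℝ) {ρ : ℝ} (hρ : 0 < ρ) (k : ℕ)
    (h : Fin N → ℝ) : 0 ≤ ballMass M ρ k h := by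
  unfold ballMass
  split_ifs
  · exact zero_le_one
  · exact integral_nonneg fun z => noiseDensity_nonneg _ hρ _

/-- The total mass of the noise bounds every ball, uniformly in the channel. -/
theorem exists_ballMass_le (M : Matrix (Fin N) (Fin N) ℝ) {ρ : ℝ} (hρ : 0 < ρ) (k : ℕ) :
    ∃ C, ∀ h, ballMass M ρ k h ≤ C := by
  by_cases hk : k = 0
  · exact ⟨1, fun h => by simp [ballMass, hk]⟩
  · refine ⟨∫ z : EuclideanSpace ℝ (Fin k), noiseDensity k ρ ‖z‖, fun h => ?_⟩
    rw [ballMass, if_neg hk]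
    exact setIntegral_le_integral (integrable_noiseDensity_norm k hρ)
      (.of_forall fun z => noiseDensity_nonneg _ hρ _)

theorem sphereProb_nonneg (M : Matrix (Fin N) (Fin N) ℝ) {K : ℕ} (hK : 1 ≤ K) {ρ : ℝ}
    (hρ : 0 < ρ) (h : Fin N → ℝ) : 0 ≤ sphereProb M K ρ h := by
  have hK' : (0 : ℝ) ≤ K - 1 := sub_nonneg.2 (by exact_mod_cast hK)
  exact div_nonneg (Finset.sum_nonneg fun k _ => mul_nonneg (mul_nonneg (pow_nonneg hK' k)
    (Nat.cast_nonneg _)) (ballMass_nonneg M hρ k h)) (by positivity)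

theorem exists_sphereProb_le (M : Matrix (Fin N) (Fin N) ℝ) {K : ℕ} (hK : 1 ≤ K) {ρ : ℝ}
    (hρ : 0 < ρ) : ∃ C, ∀ h, sphereProb M K ρ h ≤ C := by
  have hK' : (0 : ℝ) ≤ K - 1 := sub_nonneg.2 (by exact_mod_cast hK)
  choose C hC using exists_ballMass_le M hρ
  refine ⟨(∑ k ∈ Finset.range (N + 1), ((K : ℝ) - 1) ^ k * (N.choose k : ℝ) * C k) / (K : ℝ) ^ N,
    fun h => ?_⟩
  unfold sphereProb
  gcongr with k hk
  exact hC k h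

end Radius

/-! ### Measurability in the channel and positivity of the gains. -/

section Measurability

variable {N : ℕ}

theorem measurable_radiusSq (M : Matrix (Fin N) (Fin N) ℝ) (k : ℕ) :
    Measurable (radiusSq M k) := by
  unfold radiusSq
  refine measurable_const.mul ?_
  split_ifs
  · exact measurable_const.mul (.iSup fun i => (measurable_pi_apply i).pow_const 2)
  · exact (Finset.measurable_prod _ fun i _ => (measurable_pi_apply i).pow_const 2).pow_const _

theorem measurable_ballMass (M : Matrix (Fin N) (Fin N) ℝ) (ρ : ℝ) (k : ℕ) :
    Measurable (ballMass M ρ k) := by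
  unfold ballMass
  split_ifs
  · exact measurable_const
  have hA : MeasurableSet {p : (Fin N → ℝ) × EuclideanSpace ℝ (Fin k) |
      ‖p.2‖ ≤ √(radiusSq M k p.1)} :=
    measurableSet_le measurable_snd.norm ((measurable_radiusSq M k).comp measurable_fst).sqrt
  have hm := ((continuous_noiseDensity k ρ).comp
    (continuous_norm.comp (continuous_snd (X := Fin N → ℝ)
      (Y := EuclideanSpace ℝ (Fin k))))).stronglyMeasurable.indicator hA
  convert! (hm.integral_prod_right' (ν := volume)).measurable using 2 with h
  rw [← integral_indicator measurableSet_closedBall]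
  congr 1 with z
  by_cases hz : ‖z‖ ≤ √(radiusSq M k h)
  · rw [Set.indicator_of_mem (mem_closedBall_zero_iff.2 hz), Set.indicator_of_mem (by exact hz)]
    rfl
  · rw [Set.indicator_of_notMem (mt mem_closedBall_zero_iff.1 hz),
      Set.indicator_of_notMem (by exact hz)]

theorem measurable_sphereProb (M : Matrix (Fin N) (Fin N) ℝ) (K : ℕ) (ρ : ℝ) :
    Measurable (sphereProb M K ρ) := by
  unfold sphereProb
  exact (Finset.measurable_sum _ fun k _ => (measurable_ballMass M ρ k).const_mul _).div_const _

/-- Away from the degenerate channels, the reception probability is a measurable function of the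
channel. -/
theorem exists_measurable_eq_correctProb {M : Matrix (Fin N) (Fin N) ℝ} (hM : M.det ≠ 0) (K : ℕ)
    (ρ : ℝ) : ∃ g : (Fin N → ℝ) → ℝ, Measurable g ∧
      ∀ h : Fin N → ℝ, (∀ i, h i ≠ 0) → correctProb M K ρ h = g h := by
  have hS : ∀ S : Finset (Fin N), ∃ g : (Fin N → ℝ) → ℝ, Measurable g ∧
      ∀ h : Fin N → ℝ, (∀ i, h i ≠ 0) → cellMass M ρ S h = g h := by
    intro S
    by_cases hS : S = ∅
    · exact ⟨fun _ => 1, measurable_const, fun h _ => by simp [cellMass, hS]⟩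
    · exact ⟨_, measurable_gramVol_mul_integral M ρ S, fun h hh =>
        cellMass_eq_gramVol_mul M ρ hS (linearIndependent_fadedVec hM hh)⟩
  choose g hg hgeq using hS
  refine ⟨fun h => (∑ k ∈ Finset.range (N + 1), ((K : ℝ) - 1) ^ k *
    ∑ S ∈ Finset.powersetCard k (Finset.univ : Finset (Fin N)), g S h) / (K : ℝ) ^ N,
    (Finset.measurable_sum _ fun k _ =>
      (Finset.measurable_sum _ fun S _ => hg S).const_mul _).div_const _, fun h hh => ?_⟩
  simp only [correctProb, hgeq _ h hh]

theorem nakagamiMeasure_Iic_zero (m : ℝ) : nakagamiMeasure m (Set.Iic 0) = 0 := by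
  rw [nakagamiMeasure, withDensity_apply _ measurableSet_Iic]
  refine setLIntegral_eq_zero measurableSet_Iic fun x hx => ?_
  simp [nakagamiPDF, not_lt.2 (Set.mem_Iic.1 hx)]

theorem ae_pos_of_hasLaw_nakagami {Ω : Type*} [MeasurableSpace Ω] {P : Measure Ω} {m : ℝ}
    {X : Ω → ℝ} (hX : HasLaw X (nakagamiMeasure m) P) : ∀ᵐ ω ∂P, 0 < X ω := by
  have h := hX.measure_eq (p := fun x => x ≤ 0) measurableSet_Iic
  have h0 : nakagamiMeasure m {x | x ≤ 0} = 0 := nakagamiMeasure_Iic_zero m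
  rw [ae_iff]
  simpa only [not_lt, h0] using h

end Measurability

/-! ### Passage to expectations. -/

theorem theorem1 {Ω : Type*} [MeasurableSpace Ω] (P : Measure Ω) [IsProbabilityMeasure P]
    (N K L : ℕ) (hN : 1 ≤ N) (hK : 1 ≤ K)
    (M : Matrix (Fin N) (Fin N) ℝ) (hM : |M.det| = 1)
    (m : ℝ) (hm : 1 / 2 ≤ m) (ρ : ℝ) (hρ : 0 < ρ)
    (h : Fin N → Ω → ℝ) (hh : ∀ i, HasLaw (h i) (nakagamiMeasure m) P) :
    Integrable (fun ω => correctProb M K ρ (fun i => h i ω) ^ L) P ∧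
    Integrable (fun ω => sphereProb M K ρ (fun i => h i ω) ^ L) P ∧
    multipleSphereLowerBound P M K L ρ h ≤ frameErrorProb P M K L ρ h := by
  have hne : ∀ᵐ ω ∂P, ∀ i, h i ω ≠ 0 := ae_all_iff.2 fun i =>
    (ae_pos_of_hasLaw_nakagami (hh i)).mono fun ω hω => hω.ne'
  have hmeas : AEMeasurable (fun ω i => h i ω) P := aemeasurable_pi_lambda _ fun i =>
    (hh i).aemeasurable
  have hle : ∀ᵐ ω ∂P, correctProb M K ρ (fun i => h i ω) ^ L ≤
      sphereProb M K ρ (fun i => h i ω) ^ L := hne.mono fun ω hω =>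
    pow_le_pow_left₀ (correctProb_nonneg M hK hρ _) (correctProb_le_sphereProb hM hK hρ hω) L
  obtain ⟨C, hC⟩ := exists_sphereProb_le M hK hρ
  have hsphere : Integrable (fun ω => sphereProb M K ρ (fun i => h i ω) ^ L) P := by
    refine Integrable.of_bound
      (((measurable_sphereProb M K ρ).comp_aemeasurable hmeas).pow_const L).aestronglyMeasurable
      (C ^ L) (.of_forall fun ω => ?_)
    have h0 := sphereProb_nonneg M hK hρ fun i => h i ω
    rw [Real.norm_of_nonneg (pow_nonneg h0 L)]
    exact pow_le_pow_left₀ h0 (hC _) L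
  obtain ⟨g, hg, hgeq⟩ :=
    exists_measurable_eq_correctProb (M := M) (fun h0 => by simp [h0] at hM) K ρ
  have hcorrect : Integrable (fun ω => correctProb M K ρ (fun i => h i ω) ^ L) P := by
    -- Domination by `sphereProb`; measurability is transferred from `g`, which agrees almost
    -- everywhere.
    refine hsphere.mono' ?_ (hle.mono fun ω hω => ?_)
    · refine ((hg.comp_aemeasurable hmeas).pow_const L).aestronglyMeasurable.congr ?_
      filter_upwards [hne] with ω hω
      rw [hgeq _ hω]
      rfl
    · rwa [Real.norm_of_nonneg (pow_nonneg (correctProb_nonneg M hK hρ _) L)]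
  exact ⟨hcorrect, hsphere, sub_le_sub_left (integral_mono_ae hcorrect hsphere hle) 1⟩
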